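/- For even $n\ge 0$ let $\psi=\psi^{(n)}\colon\{0,1\}^n\to\{0,1\}^{n+1}$ be the following map. Given $x\in\{0,1\}^n$, repeatedly mark a pair of unmarked coordinates $i<i'$ with $x_i=1$, $x_{i'}=0$ and all coordinates strictly between them already marked, until no such pair exists (the resulting set of marked coordinates does not depend on the choices). Let $y\in\{0,1,\sqcup\}^n$ be obtained from $x$ by writing $\sqcup$ at each unmarked coordinate, let $m$ be the number of symbols $\sqcup$ in $y$, let $k=(n-m)/2$, and for $k\le i\le n-k$ let $c_i\in\{0,1\}^n$ be obtained from $y$ by replacing the $m-(i-k)$ leftmost symbols $\sqcup$ by $0$ and the remaining ones by $1$. Then $x=c_j$, where $j$ is the Hamming weight of $x$, and $$\psi(x)=\begin{cases}c_{((n-k)+j)/2}\circ 1 & \text{if } j\equiv n-k \pmod 2,\\ c_{((n-k)+j+1)/2}\circ 0 & \text{otherwise.}\end{cases}$$ Let $\psi_1$ be the family, over even $n$, of the first output bits $\psi^{(n)}(x)_1$. Let $\mathsf{majority}(x)=1$ if more than half of the bits of $x\in\{0,1\}^n$ are $1$, and $\mathsf{majority}(x)=0$ otherwise. **Proposition.**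 1. For odd $n$ and $x\in\{0,1\}^n$ let $x'\in\{0,1\}^{2n}$ be obtained from $x$ by replacing each $1$ by $10$ and each $0$ by $00$, and let $r(x)=0\circ 1^n\circ x'\in\{0,1\}^{3n+1}$. Then $3n+1$ is even, $r$ is a projection (every output bit is a constant, an input bit or a negated input bit), and $\mathsf{majority}(x)=\psi_1(r(x))$ for all $x\in\{0,1\}^n$. 2. $\mathsf{majority}$ (on all input lengths) is $\mathrm{NC}^0$-reducible to $\psi_1$: there are a constant $d$ and a polynomial $p$ such that for every $n$ there are an even $m\le p(n)$ and a map $\{0,1\}^n\to\{0,1\}^m$, computed by a Boolean circuit of fan-in at most $2$, depth at most $d$ and size at most $p(n)$, whose composition with $\psi_1$ is $\mathsf{majority}$ on $\{0,1\}^n$. 3. $\psi_1\notin\mathrm{AC}^0$: there are no constant $d$ and polynomial $p$ such that for every even $n$ the function $x\mapsto\psi^{(n)}(x)_1$ is computed by a Boolean circuit with NOT gates and unbounded fan-in AND and OR gates, of depth at most $d$ and size at most $p(n)$. -/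

import Mathlib

namespace BoolCube

/-! ### Boolean circuits -/

/-- A gate at position `i` of a circuit with `n` inputs. Its predecessors are gates at earlier
positions, so that the circuit is a directed acyclic graph. -/
inductive Gate (n i : ℕ) : Type
  | const (b : Bool) : Gate n i
  | input (j : Fin n) : Gate n i
  | not (u : Fin i) : Gate n i
  | and (S : Finset (Fin i)) : Gate n i
  | or (S : Finset (Fin i)) : Gate n i

/-- The number of predecessors of a gate. -/
def Gate.fanIn {n i : ℕ} : Gate n i → ℕ
  | .const _ => 0
  | .input _ => 0
  | .not _ => 1
  | .and S => S.card
  | .or S => S.card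

/-- A Boolean circuit with `n` inputs and `m` outputs: `size` many gates in topological order,
`m` of which (possibly with repetitions) are designated as outputs. -/
structure Circuit (n m : ℕ) where
  size : ℕ
  gate : (i : Fin size) → Gate n i
  out : Fin m → Fin size

namespace Circuit

variable {n m : ℕ}

/-- The value of the gate at position `i` on the input `x`. -/
def value (C : Circuit n m) (x : Fin n → Bool) (i : ℕ) (hi : i < C.size) : Bool :=
  match C.gate ⟨i, hi⟩ with
  | .const b => b
  | .input j => x j
  | .not u => !(C.value x u (u.isLt.trans hi))
  | .and S => decide (∀ u ∈ S, C.value x u (u.isLt.trans hi) = true)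
  | .or S => decide (∃ u ∈ S, C.value x u (u.isLt.trans hi) = true)
termination_by i
decreasing_by all_goals exact Fin.isLt _

/-- The depth of the gate at position `i`: constants and inputs have depth `0`. -/
def gateDepth (C : Circuit n m) (i : ℕ) (hi : i < C.size) : ℕ :=
  match C.gate ⟨i, hi⟩ with
  | .const _ => 0
  | .input _ => 0
  | .not u => C.gateDepth u (u.isLt.trans hi) + 1
  | .and S => S.sup (fun u => C.gateDepth u (u.isLt.trans hi)) + 1
  | .or S => S.sup (fun u => C.gateDepth u (u.isLt.trans hi)) + 1
termination_by i
decreasing_by all_goals exact Fin.isLt _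

/-- The function computed by the circuit. -/
def eval (C : Circuit n m) (x : Fin n → Bool) : Fin m → Bool :=
  fun t => C.value x (C.out t) (C.out t).isLt

/-- The depth of the circuit: the largest depth of a gate. -/
def depth (C : Circuit n m) : ℕ :=
  Finset.univ.sup fun i : Fin C.size => C.gateDepth i i.isLt

/-- Every gate has fan-in at most two. -/
def FanInTwo (C : Circuit n m) : Prop :=
  ∀ i, (C.gate i).fanIn ≤ 2

end Circuit

/-! ### Families of Boolean functions, `AC⁰`, and `NC⁰`-reductions -/

/-- A family of Boolean functions, one for each input length. -/
abbrev BoolFamily : Type := (n : ℕ) → (Fin n → Bool) → Bool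

/-- The family `f`, restricted to input lengths in `L`, is in (nonuniform) `AC⁰`: it is computed by
circuits of constant depth, polynomial size and unbounded fan-in. -/
def InAC0 (L : Set ℕ) (f : BoolFamily) : Prop :=
  ∃ (d : ℕ) (p : Polynomial ℕ), ∀ n ∈ L, ∃ C : Circuit n 1,
    C.depth ≤ d ∧ C.size ≤ p.eval n ∧ ∀ x, C.eval x 0 = f n x

/-- The family `f` on input lengths in `L` is `NC⁰`-reducible to the family `g` on input lengths in
`L'`: for each `n ∈ L` there is a map `r : {0,1}ⁿ → {0,1}ᵐ`, with `m ∈ L'` polynomially bounded,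
computed by a circuit of constant depth, polynomial size and fan-in two, such that
`f(x) = g(r(x))`. -/
def NC0Reducible (L L' : Set ℕ) (f g : BoolFamily) : Prop :=
  ∃ (d : ℕ) (p : Polynomial ℕ), ∀ n ∈ L, ∃ m ∈ L', m ≤ p.eval n ∧ ∃ C : Circuit n m,
    C.FanInTwo ∧ C.depth ≤ d ∧ C.size ≤ p.eval n ∧ ∀ x, f n x = g m (C.eval x)

/-- A projection: each output bit is a constant, an input bit, or a negated input bit. -/
def IsProjection {n m : ℕ} (r : (Fin n → Bool) → Fin m → Bool) : Prop :=
  ∀ i : Fin m, (∃ b : Bool, ∀ x, r x i = b) ∨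
    (∃ j : Fin n, ∀ x, r x i = x j) ∨ (∃ j : Fin n, ∀ x, r x i = !(x j))

/-- The Hamming weight. -/
def weight {n : ℕ} (x : Fin n → Bool) : ℕ :=
  (Finset.univ.filter fun i => x i = true).card

/-- Majority: more than half of the bits are `1`. -/
def majority : BoolFamily := fun n x => decide (n < 2 * weight x)

/-! ### The De Bruijn–Tengbergen–Kruyswijk partition -/

/-- After the coordinates in `M` are deleted from `x`, the coordinates `i` and `j` are adjacent and
hold the pair `10`. -/
def IsPair10 {n : ℕ} (x : Fin n → Bool) (M : Finset (Fin n)) (i j : Fin n) : Prop :=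
  i < j ∧ i ∉ M ∧ j ∉ M ∧ x i = true ∧ x j = false ∧ ∀ t, i < t → t < j → t ∈ M

instance IsPair10.decidable {n : ℕ} (x : Fin n → Bool) (M : Finset (Fin n)) (i j : Fin n) :
    Decidable (IsPair10 x M i j) :=
  inferInstanceAs (Decidable (i < j ∧ i ∉ M ∧ j ∉ M ∧ x i = true ∧ x j = false ∧
    ∀ t, i < t → t < j → t ∈ M))

/-- One iteration of the marking stage: mark an adjacent pair `10`, if there is one. (The final
result does not depend on which pair is picked; this definition picks the leftmost.) -/
def markStep {n : ℕ} (x : Fin n → Bool) (M : Finset (Fin n)) : Finset (Fin n) :=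
  match (List.finRange n ×ˢ List.finRange n).find? (fun q => decide (IsPair10 x M q.1 q.2)) with
  | some q => insert q.1 (insert q.2 M)
  | none => M

/-- The set of marked coordinates at the end of the marking stage. Each effective iteration marks
two new coordinates, so that `n` iterations suffice to halt. -/
def marked {n : ℕ} (x : Fin n → Bool) : Finset (Fin n) :=
  (markStep x)^[n] ∅

/-- The encoding `y ∈ {0,1,⊔}ⁿ` of the chain that contains `x`; `none` is the blank `⊔`. -/
def encoding {n : ℕ} (x : Fin n → Bool) : Fin n → Option Bool :=
  fun i => if i ∈ marked x then some (x i) else none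

/-- The number `m` of blanks of `y`. -/
def numBlanks {n : ℕ} (y : Fin n → Option Bool) : ℕ :=
  (Finset.univ.filter fun i => y i = none).card

/-- The index `k = (n - m) / 2` of the bottom vertex of the chain `C_y = {c_k, …, c_{n-k}}`. -/
def bottom {n : ℕ} (y : Fin n → Option Bool) : ℕ :=
  (n - numBlanks y) / 2

/-- The vertex `c_i` of the chain `C_y`, for `k ≤ i ≤ n - k`: the `m - (i - k)` leftmost blanks of
`y` are replaced by `0` and the other blanks by `1`. It has Hamming weight `i`. -/
def chainVertex {n : ℕ} (y : Fin n → Option Bool) (i : ℕ) : Fin n → Bool :=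
  fun t => match y t with
    | some b => b
    | none => decide (numBlanks y - (i - bottom y) ≤
        (Finset.univ.filter fun s => s < t ∧ y s = none).card)

/-! ### The map `ψ` -/

/-- The map `ψ : {0,1}ⁿ → {0,1}ⁿ⁺¹` (of interest for even `n`). The vertex `x` is `c_j` in its chain,
where `j` is its Hamming weight. -/
def psi {n : ℕ} (x : Fin n → Bool) : Fin (n + 1) → Bool :=
  let y := encoding x
  let k := bottom y
  let j := weight x
  if j ≡ n - k [MOD 2] then
    Fin.snoc (α := fun _ => Bool) (chainVertex y (((n - k) + j) / 2)) true
  else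
    Fin.snoc (α := fun _ => Bool) (chainVertex y (((n - k) + j + 1) / 2)) false

/-- The first output bit of `ψ`. -/
def psiOne : BoolFamily := fun _ x => psi x 0

/-! ### The explicit reduction -/

/-- The string `x' ∈ {0,1}²ⁿ` obtained from `x` by replacing each `1` by `10` and each `0` by
`00`. -/
def expand {n : ℕ} (x : Fin n → Bool) : Fin (2 * n) → Bool :=
  fun s => if (s : ℕ) % 2 = 0 then x ⟨s / 2, by omega⟩ else false

/-- The map `r(x) = 0 ∘ 1ⁿ ∘ x'`. -/
def reduction {n : ℕ} (x : Fin n → Bool) : Fin (1 + n + 2 * n) → Bool :=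
  Fin.append (Fin.append (fun _ : Fin 1 => false) (fun _ : Fin n => true)) (expand x)

end BoolCube

/-! Reduction. If `x` starts with 0, that coordinate stays unmarked and is the leftmost blank, so
the first bit of a chain vertex is 1 only at the top of the chain. `psi` goes roughly half-way up
from `x` to the top (rounding up), hence reaches it exactly when `x` has at most one unmarked 0. So
`psiOne` is 1 iff the initial 0 is the only unmarked one (`psiOne_eq_of_first_false`). In `0 ∘ 1ⁿ ∘
x'` marking is bracket matching with 1 as the opening bracket. There are `n + w` ones and `2n - w`
zeros after the initial 0, where `w` is the weight of `x`; since the ones in `x'` are each followed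
by their own 0, all these zeros are matched iff `2n - w ≤ n + w`, which for odd `n` is majority.
Even lengths are padded by one 0.

Lower bound. This is the Razborov–Smolensky method over the field with two elements. The gates of a
circuit of size `s` and depth `d` are approximated by polynomials of degree at most `t ^ d` that are
all correct outside a fraction `s / 2 ^ t` of the cube (`exists_circuit_approx`). On a set where
majority on `2m + 1` bits has degree at most `E`, every function has degree at most `m + E`, so the
set has at most as many points as there are monomials of that degree (`card_le_of_majority_lowDeg`).
For `E` small compared with `√m` this is less than three quarters of the cube, hence `s` is
exponential in `t` (`two_pow_lt_four_mul_size`). The circuit for `psiOne` is approximated directly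
on the inputs `r(x)`, which are affine in `x`, so no composed circuit is needed. -/

namespace BoolCube

/-! ### The marking stage -/

theorem markStep_cases {n : ℕ} (x : Fin n → Bool) (M : Finset (Fin n)) :
    (markStep x M = M ∧ ∀ i j, ¬ IsPair10 x M i j) ∨
      ∃ i j, IsPair10 x M i j ∧ markStep x M = insert i (insert j M) := by
  unfold markStep
  split
  · rename_i q hq
    right
    have := List.find?_some hq
    exact ⟨q.1, q.2, by simpa using this, rfl⟩
  · rename_i hq
    left
    refine ⟨rfl, fun i j h => ?_⟩
    rw [List.find?_eq_none] at hq
    have := hq (i, j) (by simp)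
    simp [h] at this

theorem marked_induction {n : ℕ} (x : Fin n → Bool) {P : Finset (Fin n) → Prop} (h0 : P ∅)
    (hs : ∀ M i j, IsPair10 x M i j → P M → P (insert i (insert j M))) : P (marked x) := by
  have key : ∀ t, P ((markStep x)^[t] ∅) := by
    intro t
    induction t with
    | zero => exact h0
    | succ t ih =>
      rw [Function.iterate_succ_apply']
      rcases markStep_cases x ((markStep x)^[t] ∅) with ⟨h, -⟩ | ⟨i, j, hp, h⟩
      · rwa [h]
      · rw [h]; exact hs _ _ _ hp ih
  exact key n

/-- As long as a pair is found, every iteration enlarges the marked set. If this never stops within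
`n` iterations, all coordinates are marked and no pair is left either. -/
theorem not_isPair10_marked {n : ℕ} (x : Fin n → Bool) (i j : Fin n) :
    ¬ IsPair10 x (marked x) i j := by
  have key : ∀ t, (∀ i j, ¬ IsPair10 x ((markStep x)^[t] ∅) i j) ∨
      t ≤ ((markStep x)^[t] ∅).card := by
    intro t
    induction t with
    | zero => right; simp
    | succ t ih =>
      rw [Function.iterate_succ_apply']
      rcases markStep_cases x ((markStep x)^[t] ∅) with ⟨h, hn⟩ | ⟨i, j, hp, h⟩
      · left; rw [h]; exact hn
      · rcases ih with ih | ih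
        · exact absurd hp (ih i j)
        · right
          rw [h, Finset.card_insert_of_notMem, Finset.card_insert_of_notMem hp.2.2.1]
          · omega
          · simp [hp.2.1, hp.1.ne]
  rcases key n with h | h
  · exact h i j
  · intro hp
    have : marked x = Finset.univ := by
      apply Finset.eq_univ_of_card
      apply le_antisymm (Finset.card_le_univ _)
      simpa [marked] using h
    exact hp.2.1 (this ▸ Finset.mem_univ i)

/-- The number of coordinates in `M` before position `p` at which `x` has the value `b`. -/
def countBefore {n : ℕ} (x : Fin n → Bool) (M : Finset (Fin n)) (p : ℕ) (b : Bool) : ℕ :=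
  (M.filter fun i : Fin n => (i : ℕ) < p ∧ x i = b).card

theorem countBefore_insert {n : ℕ} (x : Fin n → Bool) (M : Finset (Fin n)) (p : ℕ) (b : Bool)
    {i : Fin n} (hi : i ∉ M) :
    countBefore x (insert i M) p b =
      countBefore x M p b + if (i : ℕ) < p ∧ x i = b then 1 else 0 := by
  unfold countBefore
  rw [Finset.filter_insert]
  split_ifs with h
  · rw [Finset.card_insert_of_notMem (by simp [hi])]
  · simp

/-- All coordinates between the two members of a pair are marked, so an unmarked position `p` never
separates them: each pair contributes one 1 and one 0 before `p`, or nothing. For `p ≥ n` the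
condition is vacuous and the count is over all marked coordinates. -/
theorem countBefore_marked {n : ℕ} (x : Fin n → Bool) (p : ℕ)
    (hp : ∀ i : Fin n, (i : ℕ) = p → i ∉ marked x) :
    countBefore x (marked x) p true = countBefore x (marked x) p false := by
  revert hp
  refine marked_induction x (P := fun M => (∀ i : Fin n, (i : ℕ) = p → i ∉ M) →
    countBefore x M p true = countBefore x M p false) ?_ ?_
  · simp [countBefore]
  · rintro M i j ⟨hij, hi, hj, xi, xj, hb⟩ ih hp
    have hi' : i ∉ insert j M := by simp [hi, hij.ne]
    rw [countBefore_insert x _ p _ hi', countBefore_insert x _ p _ hj,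
      countBefore_insert x _ p _ hi', countBefore_insert x _ p _ hj,
      ih fun a ha h => hp a ha (by simp [h])]
    have h1 : (i : ℕ) < p ↔ (j : ℕ) < p := by
      constructor
      · intro h
        by_contra h2
        rcases Nat.lt_or_ge p j with h3 | h3
        · have h4 := hb ⟨p, h3.trans j.isLt⟩ (by simpa [Fin.lt_def] using h)
            (by simpa [Fin.lt_def] using h3)
          exact hp ⟨p, h3.trans j.isLt⟩ rfl (by simp [h4])
        · exact hp j (by omega) (by simp)
      · intro h; have : (i : ℕ) < j := hij
        omega
    simp [xi, xj, h1]

theorem not_mem_marked_of_val_eq_zero {n : ℕ} (x : Fin n → Bool) (i : Fin n) (hi : (i : ℕ) = 0)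
    (hx : x i = false) : i ∉ marked x := by
  refine marked_induction x (P := fun M => i ∉ M) (by simp) ?_
  rintro M a b ⟨hab, ha, hb, xa, xb, -⟩ h
  have h1 : i ≠ a := by rintro rfl; simp [hx] at xa
  have h2 : i ≠ b := by
    rintro rfl
    have : (a : ℕ) < i := hab
    omega
  simp [h, h1, h2]

/-- Between two unmarked coordinates there is no descent: the unmarked part of `x` is of the form
`0…01…1`. -/
theorem unmarked_monotone {n : ℕ} (x : Fin n → Bool) {i j : Fin n} (hij : i < j)
    (hi : i ∉ marked x) (hj : j ∉ marked x) (xi : x i = true) : x j = true := by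
  induction hd : (j : ℕ) - i using Nat.strong_induction_on generalizing i j with
  | _ d ih =>
    by_contra xj
    have xj : x j = false := by simpa using xj
    have hij' : (i : ℕ) < j := hij
    by_cases h : ∀ t, i < t → t < j → t ∈ marked x
    · exact not_isPair10_marked x i j ⟨hij, hi, hj, xi, xj, h⟩
    · push Not at h
      obtain ⟨t, h1, h2, h3⟩ := h
      have h1' : (i : ℕ) < t := h1
      have h2' : (t : ℕ) < j := h2
      have xt := ih _ (by omega) h1 hi h3 xi rfl
      have := ih _ (by omega) h2 h3 hj xt rfl
      simp [xj] at this

/-! ### The first output bit of `psi` on inputs that start with 0. -/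

theorem weight_not {n : ℕ} (x : Fin n → Bool) : weight (fun i => !(x i)) + weight x = n := by
  have := Finset.card_filter_add_card_filter_not (s := (Finset.univ : Finset (Fin n)))
    (fun i => x i = true)
  simp only [Finset.card_univ, Fintype.card_fin, Bool.not_eq_true] at this
  simp only [weight, Bool.not_eq_true']
  omega

theorem psiOne_eq_of_first_false {n : ℕ} (x : Fin n → Bool) (hn : 0 < n)
    (hx : x ⟨0, hn⟩ = false) :
    psiOne n x = decide (∀ i, i ∉ marked x → x i = false → (i : ℕ) = 0) := by
  set M := marked x with hM
  have h0 : (⟨0, hn⟩ : Fin n) ∉ M := not_mem_marked_of_val_eq_zero x _ rfl hx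
  set a := (M.filter fun i => x i = true).card with ha
  have ha' : (M.filter fun i => x i = false).card = a := by
    have := countBefore_marked x n (fun i h => absurd i.isLt (by omega))
    simpa [countBefore] using this.symm
  set u := fun b : Bool => (Finset.univ.filter fun i => i ∉ M ∧ x i = b).card with hu
  have hMcard : M.card = 2 * a := by
    rw [← Finset.card_filter_add_card_filter_not (s := M) (fun i => x i = true)]
    simp only [Bool.not_eq_true, ha', ← ha]
    ring
  have hm : numBlanks (encoding x) = u false + u true := by
    have h1 : (Finset.univ.filter fun i => encoding x i = none) =
        Finset.univ.filter fun i => i ∉ M := by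
      ext i; simp [encoding, ← hM]
    simp only [numBlanks, h1, hu]
    rw [← Finset.card_filter_add_card_filter_not (fun i => x i = false), Finset.filter_filter,
      Finset.filter_filter]
    simp
  have hw : weight x = a + u true := by
    simp only [weight, hu, ha]
    rw [← Finset.card_filter_add_card_filter_not (fun i => i ∈ M), Finset.filter_filter,
      Finset.filter_filter]
    congr 2
    · ext i; simp [and_comm]
    · ext i; simp [and_comm]
  have hN : n = 2 * a + (u false + u true) := by
    have h1 : numBlanks (encoding x) = Mᶜ.card := by
      simp only [numBlanks, encoding]
      congr 1
      ext i; simp [← hM]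
    have h2 := Finset.card_add_card_compl M
    rw [← h1, hm, hMcard, Fintype.card_fin] at h2
    exact h2.symm
  have hk : bottom (encoding x) = a := by
    rw [bottom, hm]; omega
  have hmem : (⟨0, hn⟩ : Fin n) ∈ Finset.univ.filter fun i => i ∉ M ∧ x i = false := by
    simp [h0, hx]
  have hpos : 0 < u false := Finset.card_pos.2 ⟨_, hmem⟩
  -- Coordinate 0 is the leftmost blank, so it is the last one to become 1 along the chain.
  have hcv : ∀ i, chainVertex (encoding x) i ⟨0, hn⟩ = decide (u false + u true ≤ i - a) := by
    intro i
    have hy : encoding x ⟨0, hn⟩ = none := by simp [encoding, ← hM, h0]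
    have hc : (Finset.univ.filter fun s => s < (⟨0, hn⟩ : Fin n) ∧ encoding x s = none) = ∅ := by
      ext s; simp [Fin.lt_def]
    simp only [chainVertex, hy, hc, hk, hm]
    simp [Nat.sub_eq_zero_iff_le]
  have hone : (∀ i, i ∉ M → x i = false → (i : ℕ) = 0) ↔ u false = 1 := by
    constructor
    · intro h
      refine Finset.card_eq_one.2 ⟨⟨0, hn⟩, ?_⟩
      ext i
      simp only [Finset.mem_filter, Finset.mem_univ, true_and, Finset.mem_singleton]
      constructor
      · rintro ⟨h1, h2⟩; exact Fin.ext (h i h1 h2)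
      · rintro rfl; exact ⟨h0, hx⟩
    · intro h i h1 h2
      have := Finset.card_le_one.1 h.le i (by simp [h1, h2]) _ hmem
      rw [this]
  have hz : (0 : Fin (n + 1)) = Fin.castSucc ⟨0, hn⟩ := rfl
  trans decide (u false = 1)
  swap
  · exact decide_eq_decide.2 hone.symm
  simp only [psiOne, psi]
  -- In both branches the chosen index is `a + u true + ⌈u false / 2⌉`. It reaches the top index `a
  -- + u true + u false` iff `u false ≤ 1`, and `u false` is positive.
  split_ifs with hmod
  · rw [hz, Fin.snoc_castSucc, hcv, hk, hw]
    rw [hk, hw, Nat.ModEq] at hmod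
    rw [decide_eq_decide]; omega
  · rw [hz, Fin.snoc_castSucc, hcv, hk, hw]
    rw [hk, hw, Nat.ModEq] at hmod
    rw [decide_eq_decide]; omega

/-! ### The explicit reduction -/

theorem reduction_apply {n : ℕ} (x : Fin n → Bool) (i : Fin (1 + n + 2 * n)) :
    reduction x i = if (i : ℕ) = 0 then false else if h : (i : ℕ) < 1 + n then true else
      if ((i : ℕ) - (1 + n)) % 2 = 0 then x ⟨((i : ℕ) - (1 + n)) / 2, by omega⟩ else false := by
  unfold reduction
  induction i using Fin.addCases with
  | left i =>
    rw [Fin.append_left]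
    induction i using Fin.addCases with
    | left i => rw [Fin.append_left]; simp
    | right i => rw [Fin.append_right]; simp
  | right i =>
    rw [Fin.append_right]
    simp [expand]

theorem isProjection_reduction (n : ℕ) : IsProjection (reduction (n := n)) := by
  intro i
  simp only [reduction_apply]
  split_ifs
  · exact Or.inl ⟨false, fun _ => rfl⟩
  · exact Or.inl ⟨true, fun _ => rfl⟩
  · exact Or.inr (Or.inl ⟨_, fun _ => rfl⟩)
  · exact Or.inl ⟨false, fun _ => rfl⟩

theorem weight_eq_sum {n : ℕ} (x : Fin n → Bool) :
    weight x = ∑ i, if x i = true then 1 else 0 := by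
  simp [weight]

theorem weight_append {m n : ℕ} (x : Fin m → Bool) (y : Fin n → Bool) :
    weight (Fin.append x y) = weight x + weight y := by
  simp only [weight_eq_sum, Fin.sum_univ_add, Fin.append_left, Fin.append_right]

theorem weight_expand {n : ℕ} (x : Fin n → Bool) : weight (expand x) = weight x := by
  symm
  refine Finset.card_bij (fun i _ => ⟨2 * i, by omega⟩) ?_ ?_ ?_
  · intro i hi
    simpa [expand] using hi
  · intro i _ j _ h
    rw [Fin.mk.injEq] at h
    exact Fin.ext (by omega)
  · intro s hs
    have hs : expand x s = true := (Finset.mem_filter.1 hs).2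
    unfold expand at hs
    split_ifs at hs with h
    exact ⟨⟨s / 2, by omega⟩, by simpa using hs, Fin.ext (by simp; omega)⟩

theorem weight_reduction {n : ℕ} (x : Fin n → Bool) : weight (reduction x) = n + weight x := by
  rw [reduction, weight_append, weight_append, weight_expand]
  simp [weight]

theorem majority_eq_psiOne_reduction {n : ℕ} (hn : Odd n) (x : Fin n → Bool) :
    majority n x = psiOne (1 + n + 2 * n) (reduction x) := by
  set z := reduction x with hz
  have hpos : 0 < 1 + n + 2 * n := by omega
  have hz0 : z ⟨0, hpos⟩ = false := by rw [hz, reduction_apply]; simp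
  rw [psiOne_eq_of_first_false z hpos hz0, majority, decide_eq_decide]
  set M := marked z with hM
  have h0M : (⟨0, hpos⟩ : Fin _) ∉ M := not_mem_marked_of_val_eq_zero z _ rfl hz0
  have hw : weight z = n + weight x := weight_reduction x
  have hw' : (Finset.univ.filter fun i => z i = false).card + weight z = 1 + n + 2 * n := by
    have := weight_not z
    simpa [weight] using this
  constructor
  -- An unmarked 0 at `i ≠ 0` makes the zeros outnumber the ones by at least two: marked coordinates
  -- before `i` balance, ones after `i` are at most the zeros after `i`, and coordinates 0 and `i`
  -- are two extra zeros.
  · intro hlt i hi zi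
    by_contra hi0
    have hbal : countBefore z M i true = countBefore z M i false :=
      countBefore_marked z i fun j hj => by rwa [Fin.ext hj]
    have hin : 1 + n ≤ (i : ℕ) := by
      by_contra h
      rw [hz, reduction_apply, if_neg hi0, dif_pos (by omega)] at zi
      simp at zi
    -- An unmarked 1 before the unmarked 0 at `i` would contradict `unmarked_monotone`, so every 1
    -- before `i` is marked.
    have hones : weight z ≤ countBefore z M i true +
        (Finset.univ.filter fun s => i < s ∧ z s = true).card := by
      refine le_trans (Finset.card_le_card ?_) (Finset.card_union_le _ _)
      intro s hs
      have zs : z s = true := (Finset.mem_filter.1 hs).2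
      rcases lt_trichotomy s i with h | h | h
      · have : s ∈ M := by
          by_contra hsM
          have := unmarked_monotone z h hsM hi zs
          simp [zi] at this
        simp only [Finset.mem_union, Finset.mem_filter]
        exact Or.inl ⟨this, h, zs⟩
      · rw [h, zi] at zs; simp at zs
      · simp [h, zs]
    -- Everything after `i` lies in the block `x'`, where a 1 is always the first half of a 10.
    have hnext : ∀ s : Fin (1 + n + 2 * n), i < s → z s = true →
        ∃ h : (s : ℕ) + 1 < 1 + n + 2 * n, z ⟨s + 1, h⟩ = false := by
      intro s his zs
      have his : (i : ℕ) < s := his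
      have hs := s.isLt
      rw [hz, reduction_apply, if_neg (by omega), dif_neg (by omega)] at zs
      split_ifs at zs with h
      refine ⟨by omega, ?_⟩
      rw [hz, reduction_apply, if_neg (by simp), dif_neg (by simp; omega), if_neg (by simp; omega)]
    have hafter : (Finset.univ.filter fun s => i < s ∧ z s = true).card ≤
        (Finset.univ.filter fun s => i < s ∧ z s = false).card := by
      refine Finset.card_le_card_of_injOn
        -- The value in the `else` branch is never used, by `hnext`.
        (fun s => if h : (s : ℕ) + 1 < 1 + n + 2 * n then ⟨s + 1, h⟩ else s) ?_ ?_
      · intro s hs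
        simp only [Finset.coe_filter, Finset.mem_univ, true_and, Set.mem_ofPred_eq] at hs ⊢
        obtain ⟨h, hzs⟩ := hnext s hs.1 hs.2
        rw [dif_pos h]
        refine ⟨?_, hzs⟩
        have : (i : ℕ) < s := hs.1
        exact Fin.lt_def.2 (by simp; omega)
      · intro s hs t ht hst
        simp only [Finset.coe_filter, Finset.mem_univ, true_and, Set.mem_ofPred_eq] at hs ht
        obtain ⟨h, -⟩ := hnext s hs.1 hs.2
        obtain ⟨h', -⟩ := hnext t ht.1 ht.2
        simp only [dif_pos h, dif_pos h', Fin.mk.injEq] at hst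
        exact Fin.ext (by omega)
    have hzeros : countBefore z M i false + 1 + ((Finset.univ.filter fun s =>
        i < s ∧ z s = false).card + 1) ≤ (Finset.univ.filter fun s => z s = false).card := by
      rw [← Finset.card_filter_add_card_filter_not (s := Finset.univ.filter fun s => z s = false)
        (fun s => s < i)]
      refine Nat.add_le_add ?_ ?_
      · rw [countBefore, ← Finset.card_insert_of_notMem (a := ⟨0, hpos⟩)
          fun h => h0M (Finset.mem_filter.1 h).1]
        refine Finset.card_le_card fun s hs => ?_
        rcases Finset.mem_insert.1 hs with rfl | hs
        · simp only [Finset.mem_filter, Finset.mem_univ, true_and, hz0]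
          exact Fin.lt_def.2 (Nat.pos_of_ne_zero hi0)
        · have := (Finset.mem_filter.1 hs).2
          simp only [Finset.mem_filter, Finset.mem_univ, true_and]
          exact ⟨this.2, this.1⟩
      · rw [← Finset.card_insert_of_notMem (a := i) (by simp)]
        refine Finset.card_le_card fun s hs => ?_
        rcases Finset.mem_insert.1 hs with rfl | hs
        · simp [zi]
        · have := (Finset.mem_filter.1 hs).2
          simp only [Finset.mem_filter, Finset.mem_univ, true_and]
          exact ⟨this.2, this.1.not_gt⟩
    omega
  · intro h
    have hbal : countBefore z M (1 + n + 2 * n) true = countBefore z M (1 + n + 2 * n) false :=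
      countBefore_marked z _ fun i hi => absurd i.isLt (by omega)
    have h1 : countBefore z M (1 + n + 2 * n) true ≤ weight z :=
      Finset.card_le_card fun i hi => by
        simp only [Finset.mem_filter, Finset.mem_univ, true_and] at hi ⊢
        exact hi.2.2
    have h2 : (Finset.univ.filter fun i => z i = false).card ≤
        countBefore z M (1 + n + 2 * n) false + 1 := by
      refine le_trans (Finset.card_le_card ?_) (Finset.card_insert_le ⟨0, hpos⟩ _)
      intro i hi
      have zi : z i = false := (Finset.mem_filter.1 hi).2
      by_cases hiM : i ∈ M
      · exact Finset.mem_insert_of_mem (Finset.mem_filter.2 ⟨hiM, i.isLt, zi⟩)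
      · exact Finset.mem_insert.2 (Or.inl (Fin.ext (h i hiM zi)))
    -- The counts give only `n ≤ 2 * weight x`; oddness of `n` makes this strict.
    obtain ⟨k, rfl⟩ := hn
    omega

/-! ### Projections are computed by shallow circuits -/

theorem IsProjection.comp {l m n : ℕ} {r : (Fin m → Bool) → Fin n → Bool}
    {s : (Fin l → Bool) → Fin m → Bool} (hr : IsProjection r) (hs : IsProjection s) :
    IsProjection fun x => r (s x) := by
  intro i
  rcases hr i with ⟨b, hb⟩ | ⟨j, hj⟩ | ⟨j, hj⟩
  · exact Or.inl ⟨b, fun x => hb _⟩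
  · simp only [hj]; exact hs j
  · simp only [hj]
    rcases hs j with ⟨b, hb⟩ | ⟨k, hk⟩ | ⟨k, hk⟩
    · exact Or.inl ⟨!b, fun x => by rw [hb]⟩
    · exact Or.inr (Or.inr ⟨k, fun x => by rw [hk]⟩)
    · exact Or.inr (Or.inl ⟨k, fun x => by rw [hk, Bool.not_not]⟩)

theorem exists_circuit_of_isProjection {n m : ℕ} {r : (Fin n → Bool) → Fin m → Bool}
    (hr : IsProjection r) : ∃ C : Circuit n m,
      C.FanInTwo ∧ C.depth ≤ 1 ∧ C.size = 2 * n + 2 ∧ ∀ x, C.eval x = r x := by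
  -- The gates do not depend on `r`: the two constants, then the `n` inputs, then their `n`
  -- negations, each `n` positions after its input. Only the choice of outputs depends on `r`.
  let gate : (i : Fin (2 * n + 2)) → Gate n i := fun i =>
    if h0 : (i : ℕ) = 0 then .const false else if h1 : (i : ℕ) = 1 then .const true else
      if h : (i : ℕ) < n + 2 then .input ⟨i - 2, by omega⟩ else .not ⟨i - n, by omega⟩
  have hsel : ∀ t : Fin m, ∃ i : Fin (2 * n + 2), ∀ out x,
      (Circuit.mk (n := n) (m := m) (2 * n + 2) gate out).value x i i.isLt = r x t := by
    intro t
    rcases hr t with ⟨b, hb⟩ | ⟨j, hj⟩ | ⟨j, hj⟩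
    · cases b
      · refine ⟨⟨0, by omega⟩, fun out x => ?_⟩
        rw [Circuit.value, hb]; simp [gate]
      · refine ⟨⟨1, by omega⟩, fun out x => ?_⟩
        rw [Circuit.value, hb]; simp [gate]
    · refine ⟨⟨j + 2, by omega⟩, fun out x => ?_⟩
      rw [Circuit.value, hj]; simp [gate]
    · refine ⟨⟨j + 2 + n, by omega⟩, fun out x => ?_⟩
      have h1 : ¬ (j : ℕ) + 2 + n < n + 2 := by omega
      have h2 : (j : ℕ) + 2 + n ≠ 1 := by omega
      rw [Circuit.value, hj]
      simp only [gate, h1, h2, dite_false]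
      rw [dif_neg (by omega)]
      simp only
      rw [Circuit.value]
      have h3 : (j : ℕ) + 2 + n - n = j + 2 := by omega
      simp [h3]
  choose out hout using hsel
  refine ⟨⟨2 * n + 2, gate, out⟩, ?_, ?_, rfl, fun x => funext fun t => hout t out x⟩
  · intro i
    simp only [gate]
    split_ifs <;> simp [Gate.fanIn]
  · refine Finset.sup_le fun i _ => ?_
    rw [Circuit.gateDepth]
    by_cases h : (i : ℕ) < n + 2
    · simp only [gate, h, dite_true]
      split_ifs <;> simp
    · have h1 : (i : ℕ) ≠ 0 := by omega
      have h2 : (i : ℕ) ≠ 1 := by omega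
      simp only [gate, h, h1, h2, dite_false]
      rw [Circuit.gateDepth]
      have h4 := i.isLt
      simp only at h4
      have h3 : (i : ℕ) - n < n + 2 := by omega
      simp only [h3, dite_true]
      split_ifs <;> simp

theorem majority_snoc_false {n : ℕ} (hn : Even n) (x : Fin n → Bool) :
    majority (n + 1) (Fin.snoc (α := fun _ => Bool) x false) = majority n x := by
  have : weight (Fin.snoc (α := fun _ => Bool) x false) = weight x := by
    simp only [weight_eq_sum, Fin.sum_univ_castSucc, Fin.snoc_castSucc, Fin.snoc_last]
    simp
  rw [majority, majority, this, decide_eq_decide]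
  obtain ⟨k, rfl⟩ := hn
  omega

theorem isProjection_snoc_false (n : ℕ) :
    IsProjection fun x : Fin n → Bool => (Fin.snoc (α := fun _ => Bool) x false :
      Fin (n + 1) → Bool) := by
  intro i
  induction i using Fin.lastCases with
  | last => exact Or.inl ⟨false, fun x => by simp⟩
  | cast i => exact Or.inr (Or.inl ⟨i, fun x => by simp⟩)

theorem nc0Reducible_majority_psiOne :
    NC0Reducible Set.univ {m | Even m} majority psiOne := by
  refine ⟨1, 3 * Polynomial.X + 4, fun n _ => ?_⟩
  have hp : (3 * Polynomial.X + 4 : Polynomial ℕ).eval n = 3 * n + 4 := by simp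
  rw [hp]
  rcases Nat.even_or_odd n with hn | hn
  · obtain ⟨C, h1, h2, h3, h4⟩ := exists_circuit_of_isProjection
      ((isProjection_reduction (n + 1)).comp (isProjection_snoc_false n))
    refine ⟨1 + (n + 1) + 2 * (n + 1), ?_, by omega, C, h1, h2, by omega, fun x => ?_⟩
    · obtain ⟨k, rfl⟩ := hn
      exact ⟨3 * k + 2, by ring⟩
    · rw [h4, ← majority_eq_psiOne_reduction hn.add_one, majority_snoc_false hn]
  · obtain ⟨C, h1, h2, h3, h4⟩ := exists_circuit_of_isProjection (isProjection_reduction n)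
    refine ⟨1 + n + 2 * n, ?_, by omega, C, h1, h2, by omega, fun x => ?_⟩
    · obtain ⟨k, rfl⟩ := hn
      exact ⟨3 * k + 2, by ring⟩
    · rw [h4, ← majority_eq_psiOne_reduction hn]

/-! ### Low-degree polynomials over the field with two elements -/

/-- A bit as an element of the field with two elements. -/
def bit (b : Bool) : ZMod 2 := if b then 1 else 0

@[simp] theorem bit_true : bit true = 1 := rfl
@[simp] theorem bit_false : bit false = 0 := rfl

theorem bit_not (b : Bool) : bit (!b) = 1 - bit b := by cases b <;> simp

/-- The multilinear monomial with the variables in `S`. -/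
def monomial {n : ℕ} (S : Finset (Fin n)) (x : Fin n → Bool) : ZMod 2 := ∏ i ∈ S, bit (x i)

/-- The functions on the cube that are polynomials of degree at most `D`. -/
def lowDeg (n D : ℕ) : Submodule (ZMod 2) ((Fin n → Bool) → ZMod 2) :=
  Submodule.span (ZMod 2) (monomial '' {S : Finset (Fin n) | S.card ≤ D})

theorem lowDeg_mono {n D E : ℕ} (h : D ≤ E) : lowDeg n D ≤ lowDeg n E :=
  Submodule.span_mono (Set.image_mono fun _ hS => le_trans (by exact hS) h)

theorem monomial_mem {n D : ℕ} {S : Finset (Fin n)} (h : S.card ≤ D) :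
    monomial S ∈ lowDeg n D := Submodule.subset_span ⟨S, h, rfl⟩

theorem one_mem_lowDeg (n D : ℕ) : (1 : (Fin n → Bool) → ZMod 2) ∈ lowDeg n D := by
  have : (1 : (Fin n → Bool) → ZMod 2) = monomial ∅ := by ext x; simp [monomial]
  rw [this]; exact monomial_mem (by simp)

theorem coord_mem_lowDeg {n : ℕ} (i : Fin n) : (fun x => bit (x i)) ∈ lowDeg n 1 := by
  have : (fun x : Fin n → Bool => bit (x i)) = monomial {i} := by ext x; simp [monomial]
  rw [this]; exact monomial_mem (by simp)

/-- Bits are idempotent, so repeated variables collapse; this is why degrees of functions on the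
cube are subadditive under products. -/
theorem monomial_mul {n : ℕ} (S T : Finset (Fin n)) :
    monomial S * monomial T = monomial (S ∪ T) := by
  have h : ∀ (S : Finset (Fin n)) x, monomial S x = if ∀ i ∈ S, x i = true then 1 else 0 := by
    intro S x
    split_ifs with h
    · exact Finset.prod_eq_one fun i hi => by simp [h i hi]
    · push Not at h
      obtain ⟨i, hi, hx⟩ := h
      exact Finset.prod_eq_zero hi (by simpa using congrArg bit (by simpa using hx : x i = false))
  ext x
  simp only [Pi.mul_apply, h, Finset.mem_union, or_imp, forall_and]
  by_cases h1 : ∀ i ∈ S, x i = true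
  · by_cases h2 : ∀ i ∈ T, x i = true
    · rw [if_pos h1, if_pos h2, if_pos ⟨h1, h2⟩, mul_one]
    · rw [if_neg h2, if_neg (c := _ ∧ _) fun h => h2 (And.right h), mul_zero]
  · rw [if_neg h1, if_neg (c := _ ∧ _) fun h => h1 (And.left h), zero_mul]

theorem mul_mem_lowDeg {n D E : ℕ} {f g : (Fin n → Bool) → ZMod 2} (hf : f ∈ lowDeg n D)
    (hg : g ∈ lowDeg n E) : f * g ∈ lowDeg n (D + E) := by
  have h := Submodule.mul_mem_mul hf hg
  rw [lowDeg, lowDeg, Submodule.span_mul_span] at h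
  refine Submodule.span_le.2 ?_ h
  rintro _ ⟨_, ⟨S, hS, rfl⟩, _, ⟨T, hT, rfl⟩, rfl⟩
  simp only [monomial_mul]
  have hS : S.card ≤ D := hS
  have hT : T.card ≤ E := hT
  exact monomial_mem ((Finset.card_union_le _ _).trans (by omega))

theorem comp_not_mem_lowDeg {n D : ℕ} {f : (Fin n → Bool) → ZMod 2} (hf : f ∈ lowDeg n D) :
    (fun x => f fun i => !(x i)) ∈ lowDeg n D := by
  have hmon : ∀ S : Finset (Fin n),
      (fun x => monomial S fun i => !(x i)) ∈ lowDeg n S.card := by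
    intro S
    induction S using Finset.induction_on with
    | empty => exact one_mem_lowDeg n 0
    | insert a S ha ih =>
      rw [Finset.card_insert_of_notMem ha, add_comm]
      have h1 : (1 - fun x => bit (x a)) ∈ lowDeg n 1 :=
        Submodule.sub_mem _ (one_mem_lowDeg n 1) (coord_mem_lowDeg a)
      convert mul_mem_lowDeg h1 ih using 1
      ext x
      simp [monomial, Finset.prod_insert ha, bit_not]
  let φ := LinearMap.funLeft (ZMod 2) (ZMod 2) fun (x : Fin n → Bool) (i : Fin n) => !(x i)
  have : lowDeg n D ≤ (lowDeg n D).comap φ := by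
    refine Submodule.span_le.2 ?_
    rintro _ ⟨S, hS, rfl⟩
    exact lowDeg_mono hS (hmon S)
  exact this hf

/-- If the monomial is nonzero at `x`, the support of `x` contains that of `a`, and the weights
force equality. The monomials are thus unitriangular with respect to weight, which allows
interpolation layer by layer. -/
theorem monomial_support {n : ℕ} (a x : Fin n → Bool) (h : weight x ≤ weight a) :
    monomial (Finset.univ.filter fun i => a i = true) x = if x = a then 1 else 0 := by
  split_ifs with hx
  · subst hx
    exact Finset.prod_eq_one fun i hi => by simp [(Finset.mem_filter.1 hi).2]
  · have : ∃ i, a i = true ∧ x i = false := by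
      by_contra hc
      push Not at hc
      have hsub : (Finset.univ.filter fun i => a i = true) ⊆
          Finset.univ.filter fun i => x i = true := by
        intro i hi
        have := hc i (Finset.mem_filter.1 hi).2
        simpa using this
      have heq := Finset.eq_of_subset_of_card_le hsub h
      apply hx
      ext i
      have := Finset.ext_iff.1 heq i
      simp only [Finset.mem_filter, Finset.mem_univ, true_and] at this
      exact Bool.eq_iff_iff.2 this.symm
    obtain ⟨i, h1, h2⟩ := this
    exact Finset.prod_eq_zero (i := i) (by simp [h1]) (by simp [h2])

/-- On the points of weight at most `D`, every function is a polynomial of degree at most `D`. -/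
theorem exists_lowDeg_eq_of_weight_le {n : ℕ} (D : ℕ) (f : (Fin n → Bool) → ZMod 2) :
    ∃ p ∈ lowDeg n D, ∀ x, weight x ≤ D → p x = f x := by
  have key : ∀ k ≤ D + 1, ∃ p ∈ lowDeg n D, ∀ x, weight x < k → p x = f x := by
    intro k
    induction k with
    | zero => exact fun _ => ⟨0, Submodule.zero_mem _, by simp⟩
    | succ k ih =>
      intro hk
      obtain ⟨p, hp, hpf⟩ := ih (by omega)
      -- The correction vanishes on the layers already treated and takes the value `f a - p a` at
      -- each `a` of weight `k`.
      refine ⟨p + ∑ a ∈ Finset.univ.filter (fun a : Fin n → Bool => weight a = k),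
        (f a - p a) • monomial (Finset.univ.filter fun i => a i = true),
        Submodule.add_mem _ hp (Submodule.sum_mem _ fun a ha => Submodule.smul_mem _ _
          (monomial_mem ?_)), ?_⟩
      · have : weight a = k := (Finset.mem_filter.1 ha).2
        simp only [weight] at this
        omega
      · intro x hx
        simp only [Pi.add_apply, Finset.sum_apply, Pi.smul_apply, smul_eq_mul]
        rw [Finset.sum_congr rfl fun a ha => by
          rw [monomial_support a x (by rw [(Finset.mem_filter.1 ha).2]; omega)]]
        by_cases h : weight x = k
        · simp [Finset.sum_ite_eq, h]
        · simp [Finset.sum_ite_eq, h, hpf x (by omega)]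
  obtain ⟨p, hp, h⟩ := key (D + 1) le_rfl
  exact ⟨p, hp, fun x hx => h x (by omega)⟩

/-- Every function on a set where majority has degree at most `E` is a polynomial of degree at most
`m + E`. -/
theorem card_le_of_majority_lowDeg {m E : ℕ} (g : (Fin (2 * m + 1) → Bool) → ZMod 2)
    (hg : g ∈ lowDeg (2 * m + 1) E) (S : Finset (Fin (2 * m + 1) → Bool))
    (hS : ∀ x ∈ S, g x = bit (majority _ x)) :
    S.card ≤ (Finset.univ.filter fun T : Finset (Fin (2 * m + 1)) => T.card ≤ m + E).card := by
  classical
  let ρ : ((Fin (2 * m + 1) → Bool) → ZMod 2) →ₗ[ZMod 2] (S → ZMod 2) :=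
    LinearMap.funLeft (ZMod 2) (ZMod 2) Subtype.val
  have hsurj : (lowDeg (2 * m + 1) (m + E)).map ρ = ⊤ := by
    rw [eq_top_iff]
    rintro f -
    let F : (Fin (2 * m + 1) → Bool) → ZMod 2 := fun x => if h : x ∈ S then f ⟨x, h⟩ else 0
    obtain ⟨p, hp, hpF⟩ := exists_lowDeg_eq_of_weight_le m F
    obtain ⟨q, hq, hqF⟩ := exists_lowDeg_eq_of_weight_le m fun x => F fun i => !(x i)
    -- On `S`, `g` selects the half of the cube: where majority is 0, `x` has weight at most `m` and
    -- `p` is right; where it is 1, the complement of `x` has weight at most `m` and `q` is right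
    -- there.
    refine ⟨(fun x => q fun i => !(x i)) * g + p * (1 - g), Submodule.add_mem _
      (mul_mem_lowDeg (comp_not_mem_lowDeg hq) hg)
      (mul_mem_lowDeg hp (Submodule.sub_mem _ (one_mem_lowDeg _ _) hg)), ?_⟩
    ext ⟨x, hx⟩
    have hFx : F x = f ⟨x, hx⟩ := by simp [F, hx]
    simp only [ρ, LinearMap.funLeft_apply, Pi.add_apply, Pi.mul_apply, Pi.sub_apply, Pi.one_apply,
      hS x hx, majority, ← hFx]
    have hw := weight_not x
    by_cases h : 2 * m + 1 < 2 * weight x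
    · rw [hqF _ (by omega)]; simp [h]
    · rw [hpF _ (by omega)]; simp [h]
  have h1 : Module.finrank (ZMod 2) (S → ZMod 2) = S.card := by simp
  rw [← h1, ← finrank_top, ← hsurj]
  refine (Submodule.finrank_map_le _ _).trans ?_
  have h2 : lowDeg (2 * m + 1) (m + E) = Submodule.span (ZMod 2)
      (((Finset.univ.filter fun T : Finset (Fin (2 * m + 1)) => T.card ≤ m + E).image
        monomial : Finset _) : Set ((Fin (2 * m + 1) → Bool) → ZMod 2)) := by
    rw [lowDeg]; congr 1; ext f; simp
  rw [h2]
  exact (finrank_span_finset_le_card _).trans Finset.card_image_le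

/-! ### Estimates for binomial coefficients -/

/-- A square-root-free form of `centralBinom m ≤ 4 ^ m / √(2m + 1)`. The induction step reduces to
`(2m + 1)(2m + 3) ≤ 4(m + 1)²`. -/
theorem centralBinom_sq_mul_le (m : ℕ) : m.centralBinom ^ 2 * (2 * m + 1) ≤ 16 ^ m := by
  induction m with
  | zero => simp
  | succ m ih =>
    have h := Nat.succ_mul_centralBinom_succ m
    have hpos : 0 < (m + 1) ^ 2 := by positivity
    refine Nat.le_of_mul_le_mul_left ?_ hpos
    calc (m + 1) ^ 2 * ((m + 1).centralBinom ^ 2 * (2 * (m + 1) + 1))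
        = ((m + 1) * (m + 1).centralBinom) ^ 2 * (2 * m + 3) := by ring
      _ = (m.centralBinom ^ 2 * (2 * m + 1)) * (4 * ((2 * m + 1) * (2 * m + 3))) := by
        rw [h]; ring
      _ ≤ 16 ^ m * (4 * (4 * (m + 1) ^ 2)) := by
        refine Nat.mul_le_mul ih (Nat.mul_le_mul_left _ ?_)
        nlinarith
      _ = (m + 1) ^ 2 * 16 ^ (m + 1) := by ring

/-- The layers up to `m` are exactly half of the cube, and by Pascal's rule each of the `E` further
layers is a sum of two binomial coefficients of `2m`. -/
theorem card_filter_card_le (m E : ℕ) :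
    (Finset.univ.filter fun T : Finset (Fin (2 * m + 1)) => T.card ≤ m + E).card ≤
      4 ^ m + E * (2 * m.centralBinom) := by
  have h1 : ∀ E, (Finset.univ.filter fun T : Finset (Fin (2 * m + 1)) => T.card ≤ m + E).card =
      ∑ i ∈ Finset.range (m + E + 1), (2 * m + 1).choose i := by
    intro E
    rw [Finset.card_eq_sum_card_fiberwise (f := Finset.card) (t := Finset.range (m + E + 1))]
    · refine Finset.sum_congr rfl fun i hi => ?_
      have : i ≤ m + E := by simpa [Nat.lt_succ_iff] using hi
      rw [← Finset.card_fin (2 * m + 1), ← Finset.card_powersetCard, Finset.card_fin]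
      congr 1
      ext T
      simp only [Finset.mem_filter, Finset.mem_univ, true_and, Finset.mem_powersetCard,
        Finset.subset_univ]
      constructor
      · rintro ⟨-, h⟩; exact h
      · rintro rfl; exact ⟨this, rfl⟩
    · intro T hT
      simpa [Nat.lt_succ_iff] using hT
  rw [h1]
  induction E with
  | zero => simpa using (Nat.sum_range_choose_halfway m).le
  | succ E ih =>
    rw [← add_assoc m E 1, Finset.sum_range_succ]
    have h2 : (2 * m + 1).choose (m + E + 1) ≤ 2 * m.centralBinom := by
      rw [Nat.choose_succ_succ']
      have := Nat.choose_le_centralBinom (m + E) m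
      have := Nat.choose_le_centralBinom (m + E + 1) m
      simp only [Nat.centralBinom] at *
      omega
    calc _ ≤ _ := Nat.add_le_add ih h2
      _ = _ := by ring

/-! ### Approximation of circuits by low-degree polynomials -/

/-- Fix `a` with `v a = 1`. Adding `a` to a subset flips the parity of its sum, so exactly one
subset of each such pair has sum 0. -/
theorem card_powerset_sum_eq_zero {ι : Type*} [DecidableEq ι] (S : Finset ι) (v : ι → ZMod 2)
    (hv : ∃ u ∈ S, v u ≠ 0) :
    2 * (S.powerset.filter fun R => ∑ u ∈ R, v u = 0).card ≤ 2 ^ S.card := by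
  obtain ⟨a, ha, hva⟩ := hv
  have hva : v a = 1 := by
    generalize v a = c at hva
    revert c; decide
  obtain ⟨T, haT, rfl⟩ : ∃ T, a ∉ T ∧ insert a T = S :=
    ⟨S.erase a, Finset.notMem_erase a S, Finset.insert_erase ha⟩
  rw [Finset.card_filter, Finset.sum_powerset_insert haT, ← Finset.sum_add_distrib,
    Finset.card_insert_of_notMem haT, pow_succ']
  refine Nat.mul_le_mul_left 2 ?_
  rw [← Finset.card_powerset, Finset.card_eq_sum_ones]
  refine Finset.sum_le_sum fun R hR => ?_
  rw [Finset.sum_insert fun h => haT (Finset.mem_powerset.1 hR h), hva]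
  generalize ∑ u ∈ R, v u = c
  revert c; decide

/-- Averaging over all `R ⊆ S`: each point of `B` is missed by at most half of the subsets, so some
subset misses at most half of `B`. -/
theorem exists_subset_sum_halving {ι X : Type*} [DecidableEq ι] (S : Finset ι)
    (f : ι → X → ZMod 2) (B : Finset X) (hB : ∀ x ∈ B, ∃ u ∈ S, f u x ≠ 0) :
    ∃ R ⊆ S, 2 * (B.filter fun x => ∑ u ∈ R, f u x = 0).card ≤ B.card := by
  have hsum : ∑ R ∈ S.powerset, 2 * (B.filter fun x => ∑ u ∈ R, f u x = 0).card ≤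
      ∑ _R ∈ S.powerset, B.card := by
    simp only [Finset.card_filter]
    rw [← Finset.mul_sum, Finset.sum_comm, Finset.sum_const, Finset.card_powerset, smul_eq_mul,
      Finset.mul_sum, mul_comm, ← smul_eq_mul, ← Finset.sum_const]
    refine Finset.sum_le_sum fun x hx => ?_
    rw [← Finset.card_filter]
    exact card_powerset_sum_eq_zero S (fun u => f u x) (hB x hx)
  obtain ⟨R, hR, h⟩ := Finset.exists_le_of_sum_le ⟨∅, Finset.empty_mem_powerset S⟩ hsum
  exact ⟨R, Finset.mem_powerset.1 hR, h⟩

/-- A disjunction of polynomials of degree at most `D` agrees with a polynomial of degree at most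
`t * D` except on a fraction of at most `2⁻ᵗ` of the cube; the errors are one-sided. -/
theorem exists_or_approx {ι : Type*} [DecidableEq ι] {n D : ℕ} (S : Finset ι)
    (f : ι → (Fin n → Bool) → ZMod 2) (hf : ∀ u ∈ S, f u ∈ lowDeg n D) (t : ℕ) :
    ∃ g ∈ lowDeg n (t * D), (∀ x, (∀ u ∈ S, f u x = 0) → g x = 0) ∧
      2 ^ t * (Finset.univ.filter fun x => (∃ u ∈ S, f u x ≠ 0) ∧ g x = 0).card ≤ 2 ^ n := by
  induction t with
  | zero =>
    refine ⟨0, Submodule.zero_mem _, fun _ _ => rfl, ?_⟩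
    rw [pow_zero, one_mul]
    exact (Finset.card_le_univ _).trans (by simp)
  | succ t ih =>
    obtain ⟨g, hg, hg0, hgc⟩ := ih
    obtain ⟨R, hRS, hR⟩ := exists_subset_sum_halving S f
      (Finset.univ.filter fun x => (∃ u ∈ S, f u x ≠ 0) ∧ g x = 0)
      fun x hx => (Finset.mem_filter.1 hx).2.1
    have hs : ∑ u ∈ R, f u ∈ lowDeg n D := Submodule.sum_mem _ fun u hu => hf u (hRS hu)
    -- The new polynomial is the disjunction of `g` with a parity that catches at least half of the
    -- points `g` still misses; the degree grows by `D`.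
    refine ⟨1 - (1 - g) * (1 - ∑ u ∈ R, f u), ?_, fun x hx => ?_, ?_⟩
    · rw [add_mul, one_mul]
      exact Submodule.sub_mem _ (one_mem_lowDeg _ _)
        (mul_mem_lowDeg (Submodule.sub_mem _ (one_mem_lowDeg _ _) hg)
          (Submodule.sub_mem _ (one_mem_lowDeg _ _) hs))
    · simp [hg0 x hx, Finset.sum_eq_zero fun u hu => hx u (hRS hu)]
    · have hzero : ∀ a b : ZMod 2, 1 - (1 - a) * (1 - b) = 0 → a = 0 ∧ b = 0 := by decide
      rw [pow_succ, mul_assoc]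
      refine le_trans (Nat.mul_le_mul_left _ (le_trans (Nat.mul_le_mul_left 2
        (Finset.card_le_card fun x hx => ?_)) hR)) hgc
      simp only [Finset.mem_filter, Finset.mem_univ, true_and, Pi.sub_apply, Pi.mul_apply,
        Pi.one_apply, Finset.sum_apply] at hx ⊢
      obtain ⟨h1, h2⟩ := hzero _ _ hx.2
      exact ⟨⟨hx.1, h1⟩, h2⟩

theorem bit_eq_zero {b : Bool} : bit b = 0 ↔ b = false := by cases b <;> simp

theorem bit_ne_zero {b : Bool} : bit b ≠ 0 ↔ b = true := by cases b <;> simp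

theorem IsProjection.bit_mem_lowDeg {n N : ℕ} {r : (Fin n → Bool) → Fin N → Bool}
    (hr : IsProjection r) (j : Fin N) : (fun x => bit (r x j)) ∈ lowDeg n 1 := by
  rcases hr j with ⟨b, hb⟩ | ⟨i, hi⟩ | ⟨i, hi⟩
  · simp only [hb]
    convert Submodule.smul_mem _ (bit b) (one_mem_lowDeg n 1) using 1
    ext x; simp
  · simp only [hi]; exact coord_mem_lowDeg i
  · simp only [hi, bit_not]
    exact Submodule.sub_mem _ (one_mem_lowDeg n 1) (coord_mem_lowDeg i)

/-- The approximation of a single gate, given approximations of the earlier gates. -/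
theorem exists_gate_approx {n N m : ℕ} (C : Circuit N m) {r : (Fin n → Bool) → Fin N → Bool}
    (hr : IsProjection r) {t : ℕ} (ht : 1 ≤ t) {k : ℕ} (hk : k < C.size)
    (p : ℕ → (Fin n → Bool) → ZMod 2)
    (hp : ∀ i (hi : i < C.size), i < k → p i ∈ lowDeg n (t ^ C.gateDepth i hi)) :
    ∃ q ∈ lowDeg n (t ^ C.gateDepth k hk),
      2 ^ t * (Finset.univ.filter fun x =>
        (∀ i (hi : i < C.size), i < k → p i x = bit (C.value (r x) i hi)) ∧
          q x ≠ bit (C.value (r x) k hk)).card ≤ 2 ^ n := by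
  -- Only points where all earlier approximations are correct count as errors here, so constants,
  -- inputs and negations cause none. For AND, `exists_or_approx` is used through De Morgan's law.
  rcases hgate : C.gate ⟨k, hk⟩ with b | j | u | S | S
  · refine ⟨fun _ => bit b, ?_, ?_⟩
    · convert Submodule.smul_mem _ (bit b) (one_mem_lowDeg n _) using 1
      ext x; simp
    · rw [Finset.filter_false_of_mem]
      · simp
      · rintro x - ⟨-, h2⟩
        apply h2
        rw [Circuit.value, hgate]
  · refine ⟨fun x => bit (r x j), ?_, ?_⟩
    · rw [Circuit.gateDepth, hgate]; exact hr.bit_mem_lowDeg j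
    · rw [Finset.filter_false_of_mem]
      · simp
      · rintro x - ⟨-, h2⟩
        apply h2
        rw [Circuit.value, hgate]
  · refine ⟨1 - p u, ?_, ?_⟩
    · rw [Circuit.gateDepth, hgate]
      exact Submodule.sub_mem _ (one_mem_lowDeg n _)
        (lowDeg_mono (Nat.pow_le_pow_right ht (Nat.le_succ _)) (hp u (u.isLt.trans hk) u.isLt))
    · rw [Finset.filter_false_of_mem]
      · simp
      · rintro x - ⟨h1, h2⟩
        apply h2
        rw [Circuit.value, hgate]
        simp only [Pi.sub_apply, Pi.one_apply, h1 u (u.isLt.trans hk) u.isLt, bit_not]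
  · have hS : ∀ u ∈ S, 1 - p u ∈
        lowDeg n (t ^ S.sup fun u : Fin k => C.gateDepth u (u.isLt.trans hk)) := fun u hu =>
      Submodule.sub_mem _ (one_mem_lowDeg n _) (lowDeg_mono (Nat.pow_le_pow_right ht
        (Finset.le_sup (f := fun u : Fin k => C.gateDepth u (u.isLt.trans hk)) hu))
        (hp u (u.isLt.trans hk) u.isLt))
    obtain ⟨g, hg, hg0, hgc⟩ := exists_or_approx S (fun u : Fin k => 1 - p u) hS t
    refine ⟨1 - g, ?_, le_trans (Nat.mul_le_mul_left _ (Finset.card_le_card fun x hx => ?_)) hgc⟩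
    · rw [Circuit.gateDepth, hgate]
      simp only [pow_succ']
      exact Submodule.sub_mem _ (one_mem_lowDeg n _) hg
    · simp only [Finset.mem_filter, Finset.mem_univ, true_and] at hx ⊢
      obtain ⟨h1, h2⟩ := hx
      rw [Circuit.value, hgate] at h2
      have hv : ∀ u : Fin k, (1 - p u) x = bit (!C.value (r x) u (u.isLt.trans hk)) := fun u => by
        simp only [Pi.sub_apply, Pi.one_apply, h1 u (u.isLt.trans hk) u.isLt, bit_not]
      have hg0 := hg0 x
      simp only [hv, bit_eq_zero, bit_ne_zero, Bool.not_eq_false', Bool.not_eq_true'] at hg0 ⊢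
      by_cases hall : ∀ u ∈ S, C.value (r x) u (u.isLt.trans hk) = true
      · refine absurd ?_ h2
        simp only [decide_eq_true hall, bit_true, Pi.sub_apply, Pi.one_apply, hg0 hall, sub_zero]
      · have hex : ∃ u ∈ S, C.value (r x) u (u.isLt.trans hk) = false := by
          simpa using hall
        refine ⟨hex, ?_⟩
        simp only [decide_eq_false hall, bit_false, Pi.sub_apply, Pi.one_apply] at h2
        generalize g x = c at h2
        revert c; decide
  · have hS : ∀ u ∈ S, p u ∈
        lowDeg n (t ^ S.sup fun u : Fin k => C.gateDepth u (u.isLt.trans hk)) := fun u hu =>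
      lowDeg_mono (Nat.pow_le_pow_right ht
        (Finset.le_sup (f := fun u : Fin k => C.gateDepth u (u.isLt.trans hk)) hu))
        (hp u (u.isLt.trans hk) u.isLt)
    obtain ⟨g, hg, hg0, hgc⟩ := exists_or_approx S (fun u : Fin k => p u) hS t
    refine ⟨g, ?_, le_trans (Nat.mul_le_mul_left _ (Finset.card_le_card fun x hx => ?_)) hgc⟩
    · rw [Circuit.gateDepth, hgate]
      simp only [pow_succ']
      exact hg
    · simp only [Finset.mem_filter, Finset.mem_univ, true_and] at hx ⊢
      obtain ⟨h1, h2⟩ := hx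
      rw [Circuit.value, hgate] at h2
      have hv : ∀ u : Fin k, p u x = bit (C.value (r x) u (u.isLt.trans hk)) := fun u =>
        h1 u (u.isLt.trans hk) u.isLt
      have hg0 := hg0 x
      simp only [hv, bit_eq_zero, bit_ne_zero] at hg0 ⊢
      by_cases hex : ∃ u ∈ S, C.value (r x) u (u.isLt.trans hk) = true
      · refine ⟨hex, ?_⟩
        simp only [decide_eq_true hex, bit_true] at h2
        generalize g x = c at h2
        revert c; decide
      · refine absurd ?_ h2
        simp only [decide_eq_false hex, bit_false]
        exact hg0 (by simpa using hex)

/-- On inputs given by a projection, all gates of a circuit are simultaneously approximated by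
polynomials, whose degrees depend on the depths only. -/
theorem exists_circuit_approx {n N m : ℕ} (C : Circuit N m) {r : (Fin n → Bool) → Fin N → Bool}
    (hr : IsProjection r) {t : ℕ} (ht : 1 ≤ t) :
    ∃ p : ℕ → (Fin n → Bool) → ZMod 2,
      (∀ i (hi : i < C.size), p i ∈ lowDeg n (t ^ C.gateDepth i hi)) ∧
      2 ^ t * (Finset.univ.filter fun x =>
        ∃ i, ∃ hi : i < C.size, p i x ≠ bit (C.value (r x) i hi)).card ≤ C.size * 2 ^ n := by
  have key : ∀ k ≤ C.size, ∃ p : ℕ → (Fin n → Bool) → ZMod 2,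
      (∀ i (hi : i < C.size), i < k → p i ∈ lowDeg n (t ^ C.gateDepth i hi)) ∧
      2 ^ t * (Finset.univ.filter fun x =>
        ∃ i, ∃ hi : i < C.size, i < k ∧ p i x ≠ bit (C.value (r x) i hi)).card ≤ k * 2 ^ n := by
    intro k
    induction k with
    | zero => exact fun _ => ⟨0, by simp, by simp⟩
    | succ k ih =>
      intro hk
      obtain ⟨p, hp, hpc⟩ := ih (by omega)
      obtain ⟨q, hq, hqc⟩ := exists_gate_approx C hr ht (k := k) (by omega) p hp
      refine ⟨Function.update p k q, fun i hi hik => ?_, ?_⟩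
      · rcases Nat.lt_succ_iff_lt_or_eq.1 hik with h | rfl
        · rw [Function.update_of_ne h.ne]; exact hp i hi h
        · rw [Function.update_self]; exact hq
      · rw [add_mul, one_mul]
        refine le_trans ?_ (Nat.add_le_add hpc hqc)
        rw [← mul_add]
        refine Nat.mul_le_mul_left _ (le_trans (Finset.card_le_card fun x hx => ?_)
          (Finset.card_union_le _ _))
        simp only [Finset.mem_union, Finset.mem_filter, Finset.mem_univ, true_and] at hx ⊢
        -- Each bad point is charged to an earlier gate or else to gate `k` with all earlier gates
        -- correct; this is the union bound over gates.
        by_cases hgood : ∃ i, ∃ hi : i < C.size, i < k ∧ p i x ≠ bit (C.value (r x) i hi)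
        · exact Or.inl hgood
        · right
          push Not at hgood
          refine ⟨fun i hi h => hgood i hi h, ?_⟩
          obtain ⟨i, hi, hik, hne⟩ := hx
          rcases Nat.lt_succ_iff_lt_or_eq.1 hik with h | rfl
          · rw [Function.update_of_ne h.ne] at hne
            exact absurd (hgood i hi h) hne
          · rwa [Function.update_self] at hne
  obtain ⟨p, hp, hpc⟩ := key C.size le_rfl
  refine ⟨p, fun i hi => hp i hi hi, le_trans (Nat.mul_le_mul_left _ (Finset.card_le_card
    fun x hx => ?_)) hpc⟩
  simp only [Finset.mem_filter, Finset.mem_univ, true_and] at hx ⊢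
  obtain ⟨i, hi, h⟩ := hx
  exact ⟨i, hi, hi, h⟩

/-! ### Majority is not computed by small circuits of small depth -/

theorem two_pow_lt_four_mul_size {m N t : ℕ} (ht : 1 ≤ t) (C : Circuit N 1)
    {r : (Fin (2 * m + 1) → Bool) → Fin N → Bool} (hr : IsProjection r)
    (hC : ∀ x, C.eval (r x) 0 = majority _ x) (hm : 16 * (t ^ C.depth) ^ 2 ≤ 2 * m) :
    2 ^ t < 4 * C.size := by
  by_contra! hsize
  obtain ⟨p, hp, hpc⟩ := exists_circuit_approx C hr ht
  set E := t ^ C.depth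
  set B := Finset.univ.filter fun x =>
    ∃ i, ∃ hi : i < C.size, p i x ≠ bit (C.value (r x) i hi)
  have hpos : 0 < C.size := (Nat.zero_le _).trans_lt (C.out 0).isLt
  have hB : 4 * B.card ≤ 2 ^ (2 * m + 1) := by
    refine Nat.le_of_mul_le_mul_left ?_ hpos
    calc C.size * (4 * B.card) = 4 * C.size * B.card := by ring
      _ ≤ 2 ^ t * B.card := Nat.mul_le_mul_right _ hsize
      _ ≤ _ := hpc
  have hdeg : p (C.out 0) ∈ lowDeg (2 * m + 1) E :=
    lowDeg_mono (Nat.pow_le_pow_right ht (Finset.le_sup (f := fun i : Fin C.size =>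
      C.gateDepth i i.isLt) (Finset.mem_univ (C.out 0)))) (hp _ (C.out 0).isLt)
  have hS : Bᶜ.card ≤ 4 ^ m + E * (2 * m.centralBinom) := by
    refine (card_le_of_majority_lowDeg _ hdeg Bᶜ fun x hx => ?_).trans (card_filter_card_le m E)
    rw [← hC, Circuit.eval]
    by_contra hne
    exact Finset.mem_compl.1 hx (Finset.mem_filter.2 ⟨Finset.mem_univ _, _, _, hne⟩)
  have hcard : B.card + Bᶜ.card = 2 ^ (2 * m + 1) := by
    rw [Finset.card_add_card_compl]; simp
  have h2 : 2 ^ (2 * m + 1) = 2 * 4 ^ m := by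
    rw [pow_succ, pow_mul]; norm_num [mul_comm]
  rw [h2] at hB hcard
  -- The complement of `B` has at least `(3/2) * 4 ^ m` points, while `hS` bounds it by `4 ^ m` plus
  -- the extra layers.
  have h4 : 4 ^ m ≤ 4 * (E * m.centralBinom) := by
    have : E * (2 * m.centralBinom) = 2 * (E * m.centralBinom) := by ring
    omega
  have h16 : 16 ^ m ≤ 16 * E ^ 2 * m.centralBinom ^ 2 := by
    calc (16 : ℕ) ^ m = (4 ^ m) ^ 2 := by rw [← pow_mul, mul_comm, pow_mul]; norm_num
      _ ≤ (4 * (E * m.centralBinom)) ^ 2 := Nat.pow_le_pow_left h4 2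
      _ = _ := by ring
  have hcb := centralBinom_sq_mul_le m
  have hcpos : 0 < m.centralBinom ^ 2 := pow_pos m.centralBinom_pos 2
  -- The contradiction is the gap between `2 * m + 1` and `2 * m`.
  have : m.centralBinom ^ 2 * (2 * m + 1) ≤ m.centralBinom ^ 2 * (2 * m) :=
    calc _ ≤ _ := hcb
      _ ≤ _ := h16
      _ = m.centralBinom ^ 2 * (16 * E ^ 2) := by ring
      _ ≤ _ := Nat.mul_le_mul_left _ hm
  have := Nat.le_of_mul_le_mul_left this hcpos
  omega

theorem tendsto_eval_div_two_pow (q : Polynomial ℕ) :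
    Filter.Tendsto (fun t : ℕ => ((q.eval t : ℕ) : ℝ) / 2 ^ t) Filter.atTop (nhds 0) := by
  induction q using Polynomial.induction_on' with
  | add p q hp hq =>
    simpa [add_div] using hp.add hq
  | monomial k a =>
    have := (tendsto_pow_const_div_const_pow_of_one_lt k (r := (2 : ℝ)) (by norm_num)).const_mul
      (a : ℝ)
    simpa [Polynomial.eval_monomial, mul_div_assoc] using this

theorem exists_eval_le_two_pow (q : Polynomial ℕ) : ∃ t : ℕ, 1 ≤ t ∧ q.eval t ≤ 2 ^ t := by
  have h := (tendsto_eval_div_two_pow q).eventually (gt_mem_nhds one_pos)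
  obtain ⟨t, h1, h2⟩ := (h.and (Filter.eventually_ge_atTop 1)).exists
  refine ⟨t, h2, ?_⟩
  rw [div_lt_one (by positivity)] at h1
  exact_mod_cast h1.le

theorem not_inAC0_psiOne : ¬ InAC0 {n | Even n} psiOne := by
  rintro ⟨d, p, h⟩
  -- With `m = 8 * t ^ (2 * d)` the degree condition `16 * (t ^ d) ^ 2 ≤ 2 * m` is an equality. The
  -- input length of `psiOne` is then `3 * (16 * t ^ (2 * d) + 1) + 1`, a polynomial in `t`, so four
  -- times the size bound is at most `2 ^ t` for a suitable `t`.
  obtain ⟨t, ht, hle⟩ := exists_eval_le_two_pow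
    (4 * p.comp (3 * (16 * Polynomial.X ^ (2 * d) + 1) + 1))
  set m := 8 * t ^ (2 * d) with hm
  have hodd : Odd (2 * m + 1) := ⟨m, rfl⟩
  obtain ⟨C, hd, hs, hC⟩ := h (1 + (2 * m + 1) + 2 * (2 * m + 1)) ⟨3 * m + 2, by ring⟩
  have hlt := two_pow_lt_four_mul_size ht C (isProjection_reduction (2 * m + 1))
    (fun x => by rw [hC, majority_eq_psiOne_reduction hodd]) (by
      have := Nat.pow_le_pow_left (Nat.pow_le_pow_right ht hd) 2
      rw [← pow_mul t d, mul_comm d] at this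
      omega)
  have heval : (4 * p.comp (3 * (16 * Polynomial.X ^ (2 * d) + 1) + 1)).eval t =
      4 * p.eval (1 + (2 * m + 1) + 2 * (2 * m + 1)) := by
    simp only [Polynomial.eval_mul, Polynomial.eval_comp, Polynomial.eval_add,
      Polynomial.eval_pow, Polynomial.eval_X, Polynomial.eval_ofNat, Polynomial.eval_one]
    congr 2
    omega
  omega

end BoolCube

theorem mainTheorem7 :
    (∀ n : ℕ, Odd n →
      Even (1 + n + 2 * n) ∧
      BoolCube.IsProjection (BoolCube.reduction (n := n)) ∧
      ∀ x : Fin n → Bool,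
        BoolCube.majority n x = BoolCube.psiOne (1 + n + 2 * n) (BoolCube.reduction x)) ∧
    BoolCube.NC0Reducible Set.univ {m | Even m} BoolCube.majority BoolCube.psiOne ∧
    ¬ BoolCube.InAC0 {n | Even n} BoolCube.psiOne := by
  refine ⟨fun n hn => ⟨?_, BoolCube.isProjection_reduction n,
    BoolCube.majority_eq_psiOne_reduction hn⟩, BoolCube.nc0Reducible_majority_psiOne,
    BoolCube.not_inAC0_psiOne⟩
  obtain ⟨k, rfl⟩ := hn
  exact ⟨3 * k + 2, by ring⟩
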